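/- **Finite convergence of DiPOA with second-order cuts.** *Setting.* Let $f_1,\dots,f_N:\mathbb R^n\to\mathbb R$ be twice differentiable with $\nabla^2 f_i(x)\succeq m_i I$ for all $x$, where $m_i>0$; let $g_1,\dots,g_m:\mathbb R^n\to\mathbb R$ be convex and continuously differentiable; let $\Omega=\{x: Dx\le d,\ Ax=b\}$ be bounded, $\kappa\in\mathbb N$, and let $\mathcal E_1,\dots,\mathcal E_K\subseteq\{1,\dots,N\}$ be nonempty hyperedges. Put $\mathcal X=\{x\in\Omega: g_h(x)\le 0\ \forall h\}$. The sparse convex program (SCP) is to minimize $\sum_i f_i(x)$ over $x\in\mathcal X$ with $\|x\|_0\le\kappa$. Its consensus form is $$P_2:\quad \min_{\tilde x,\tilde y}\ \sum_{i} f_i(x_i)\quad\text{s.t. } x_i\in\mathcal X\ \forall i,\quad x_i=y_j\ \forall i\in\mathcal E_j,\ \forall j,\quad \|y_j\|_0\le\kappa\ \forall j .$$ Let $M_j$ be so large that $\|x\|_\infty\le M_j$ for all $x\in\Omega$. For $z=(z_1,\dots,z_K)$ with $z_j\in\{0,1\}^n$ let $L(z)$ be the set of $(\tilde x,\tilde y)$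 with $x_i\in\Omega$ for all $i$, $x_i=y_j$ for $i\in\mathcal E_j$, and $-M_jz_j\le y_j\le M_jz_j$ for all $j$; the primal problem $P_7(z)$ is to minimize $\sum_i f_i(x_i)$ over $(\tilde x,\tilde y)\in L(z)$ with $g_h(x_i)\le0$ for all $i,h$. Assume that for every $z$ with $\sum_l z_{j,l}\le\kappa$ for all $j$, Abadie's constraint qualification (every direction of the linearized cone is tangent to the feasible set) holds for $P_7(z)$ at its optimal solutions. *Algorithm.* Start from $z^0$ with $\sum_l z^0_{j,l}\le\kappa$ for all $j$ and with $P_7(z^0)$ feasible. In iteration $k=1,2,\dots$: (a) if $P_7(z^{k-1})$ is feasible, let $(\tilde x^k,\tilde y^k)$ be an optimal solution of it; otherwise let it be either a minimizer of $\sum_{i,h}g_h(x_i)$ over $L(z^{k-1})$ whose value is positive, or a minimizer of $\sum_{i,h}\max\{g_h(x_i),0\}$ over $L(z^{k-1})$; (b) let $(\alpha^{(k)},\tilde x^{(k)},\tilde y^{(k)},z^k)$ be an optimal solution of the master problem $$\text{MIQCP}_k:\quad \min\ \sum_i\alpha_i\quad\text{s.t. } (\tilde x,\tilde y)\in L(z),\quad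 z_j\in\{0,1\}^n,\quad \textstyle\sum_l z_{j,l}\le\kappa\ \forall j,$$ and, for all $\ell=1,\dots,k$: - $\alpha_i\ge f_i(x_i^\ell)+\nabla f_i(x_i^\ell)^T(x_i-x_i^\ell)+\frac{m_i}{2}\|x_i-x_i^\ell\|_2^2$ for all $i$ with $x_i^\ell\in\mathcal X$; - $0\ge\nabla g_h(x_i^\ell)^T(x_i-x_i^\ell)$ for all $i$ with $x_i^\ell\in\mathcal X\cap\partial\mathcal X$ and all $h$ with $g_h(x_i^\ell)=0$; - if some $x_i^\ell\notin\mathcal X$: $g_h(x_i^\ell)+\nabla g_h(x_i^\ell)^T(x_i-x_i^\ell)\le0$ for all $i,h$. *Claim.* 1. For all $i$ and all $c,x\in\mathbb R^n$: $f_i(x)\ge f_i(c)+\nabla f_i(c)^T(x-c)+\frac{m_i}{2}\|x-c\|_2^2$. 2. No feasible point is cut off, whatever the points at which the cuts are generated: for every feasible $(\tilde x,\tilde y)$ of $P_2$ there is a $z$ such that $((f_i(x_i))_i,\tilde x,\tilde y,z)$ is feasible for $\text{MIQCP}_k$ for every $k$. The same holds for $x_i=y_j=x$ with any feasible $x$ of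 the SCP. 3. For every run of the algorithm there is a $k^*$ such that for all $k\ge k^*$ the optimal solution of $\text{MIQCP}_k$ computed in the run solves $P_2$, that is, $(\tilde x^{(k)},\tilde y^{(k)})$ is an optimal solution of $P_2$ and $\alpha^{(k)}_i=f_i(x^{(k)}_i)$ for all $i$ (so the optimal values agree); and, conversely, for every optimal solution $(\tilde x,\tilde y)$ of $P_2$ there is a $z$ such that $((f_i(x_i))_i,\tilde x,\tilde y,z)$ is an optimal solution of $\text{MIQCP}_k$. -/

import Mathlib

open scoped Matrix

namespace DiPOA

/-- `f` is twice differentiable on `ℝⁿ`, `m > 0`, and its Hessian satisfies `∇²f(x) ⪰ m I`. -/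
def IsStronglyConvex {n : ℕ} (m : ℝ) (f : EuclideanSpace ℝ (Fin n) → ℝ) : Prop :=
  0 < m ∧ Differentiable ℝ f ∧ Differentiable ℝ (fderiv ℝ f) ∧
    ∀ x v, m * ‖v‖ ^ 2 ≤ fderiv ℝ (fderiv ℝ f) x v v

/-- The data of a sparse convex program distributed over a hypergraph: `N` nodes, `K` hyperedges,
`n` variables, `H` nonlinear constraints, `p` linear inequalities and `q` linear equations. -/
structure Problem (N K n H p q : ℕ) where
  /-- local objectives -/
  f : Fin N → EuclideanSpace ℝ (Fin n) → ℝ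
  /-- strong convexity parameters used in the quadratic cuts -/
  μ : Fin N → ℝ
  /-- nonlinear constraints -/
  g : Fin H → EuclideanSpace ℝ (Fin n) → ℝ
  /-- matrix of the linear inequalities -/
  D : Matrix (Fin p) (Fin n) ℝ
  /-- right-hand side of the linear inequalities -/
  d : Fin p → ℝ
  /-- matrix of the linear equations -/
  A : Matrix (Fin q) (Fin n) ℝ
  /-- right-hand side of the linear equations -/
  b : Fin q → ℝ
  /-- hyperedges -/
  E : Fin K → Finset (Fin N)
  /-- sparsity level -/
  κ : ℕ
  /-- big-M constants -/
  M : Fin K → ℝ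

/-- A pair `(x̃, ỹ)`: one copy `x i` per node and one auxiliary vector `y j` per hyperedge. -/
abbrev Point (N K n : ℕ) : Type :=
  (Fin N → EuclideanSpace ℝ (Fin n)) × (Fin K → EuclideanSpace ℝ (Fin n))

/-- Binary vectors `z_1, …, z_K ∈ {0,1}ⁿ`. -/
abbrev Binary (K n : ℕ) : Type := Fin K → Fin n → Bool

/-- The variables `(α, x̃, ỹ, z̃)` of the master problem. -/
structure MasterPoint (N K n : ℕ) where
  /-- epigraph variables -/
  α : Fin N → ℝ
  /-- the pair `(x̃, ỹ)` -/
  pt : Point N K n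
  /-- the binary variables -/
  z : Binary K n

/-- `a` is an optimal solution of `min F` over the feasible set `S`. -/
def IsOptimal {β : Type*} (F : β → ℝ) (S : Set β) (a : β) : Prop :=
  a ∈ S ∧ IsMinOn F S a

/-- The number of nonzero entries of a vector. -/
noncomputable def l0 {n : ℕ} (x : EuclideanSpace ℝ (Fin n)) : ℕ :=
  (Finset.univ.filter fun l => x l ≠ 0).card

namespace Problem

variable {N K n H p q : ℕ} (P : Problem N K n H p q)

/-- The polyhedron `Ω = {x : D x ≤ d, A x = b}`. -/
def Ω : Set (EuclideanSpace ℝ (Fin n)) :=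
  {x | (∀ r, (P.D *ᵥ x.ofLp) r ≤ P.d r) ∧ P.A *ᵥ x.ofLp = P.b}

/-- The set `X = {x ∈ Ω : g(x) ≤ 0}`. -/
def X : Set (EuclideanSpace ℝ (Fin n)) := {x | x ∈ P.Ω ∧ ∀ h, P.g h x ≤ 0}

/-- The feasible set of the sparse convex program in the single global variable `x`. -/
def scpFeasible : Set (EuclideanSpace ℝ (Fin n)) := {x | x ∈ P.X ∧ l0 x ≤ P.κ}

/-- The objective `∑ i, f_i(x_i)`. -/
def objective (w : Point N K n) : ℝ := ∑ i, P.f i (w.1 i)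

/-- The consensus constraints `x_i = y_j` for `i ∈ E_j`. -/
def Consensus (w : Point N K n) : Prop := ∀ j, ∀ i ∈ P.E j, w.1 i = w.2 j

/-- The feasible set of the consensus form (problem `P₂`) of the sparse convex program. -/
def consensusFeasible : Set (Point N K n) :=
  {w | (∀ i h, P.g h (w.1 i) ≤ 0) ∧ P.Consensus w ∧ (∀ i, w.1 i ∈ P.Ω) ∧
    ∀ j, l0 (w.2 j) ≤ P.κ}

/-- `z_j` has at most `κ` ones for every `j`. -/
def CardOK (z : Binary K n) : Prop := ∀ j, ∑ l, (z j l).toNat ≤ P.κ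

/-- The linear constraints on `(x̃, ỹ)` for fixed binary vectors: consensus, `x_i ∈ Ω`, and
`-M_j z_j ≤ y_j ≤ M_j z_j`. -/
def linearFeasible (z : Binary K n) : Set (Point N K n) :=
  {w | P.Consensus w ∧ (∀ i, w.1 i ∈ P.Ω) ∧
    ∀ j l, -(P.M j * ((z j l).toNat : ℝ)) ≤ w.2 j l ∧ w.2 j l ≤ P.M j * ((z j l).toNat : ℝ)}

/-- The feasible set of the primal problem for fixed binary vectors; its objective is
`P.objective`. -/
def primalFeasible (z : Binary K n) : Set (Point N K n) :=
  {w | w ∈ P.linearFeasible z ∧ ∀ i h, P.g h (w.1 i) ≤ 0}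

/-- The linearized cone of the primal problem at `w`: the directions `(u, v)` that satisfy to first
order every equation and every inequality active at `w`. -/
def linearizedCone (z : Binary K n) (w : Point N K n) : Set (Point N K n) :=
  {e | (∀ i h, P.g h (w.1 i) = 0 → inner ℝ (gradient (P.g h) (w.1 i)) (e.1 i) ≤ 0) ∧
    P.Consensus e ∧
    (∀ i r, (P.D *ᵥ (w.1 i).ofLp) r = P.d r → (P.D *ᵥ (e.1 i).ofLp) r ≤ 0) ∧
    (∀ i, P.A *ᵥ (e.1 i).ofLp = 0) ∧
    ∀ j l, (w.2 j l = P.M j * ((z j l).toNat : ℝ) → e.2 j l ≤ 0) ∧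
      (w.2 j l = -(P.M j * ((z j l).toNat : ℝ)) → 0 ≤ e.2 j l)}

/-- Abadie's constraint qualification for the primal problem at `w`: every linearized direction is
tangent to the feasible set. -/
def ConstraintQualification (z : Binary K n) (w : Point N K n) : Prop :=
  P.linearizedCone z w ⊆ posTangentConeAt (P.primalFeasible z) w

/-- `w` is a point at which feasibility cuts are generated when the primal problem for `z` is
infeasible. It minimizes over the linear constraints either the sum of the `g_h(x_i)`, with a
positive minimum (a certificate of infeasibility), or the sum of the constraint violations. -/
def IsInfeasibilityPoint (z : Binary K n) (w : Point N K n) : Prop :=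
  (IsOptimal (fun w' : Point N K n => ∑ i, ∑ h, P.g h (w'.1 i)) (P.linearFeasible z) w ∧
      0 < ∑ i, ∑ h, P.g h (w.1 i)) ∨
    IsOptimal (fun w' : Point N K n => ∑ i, ∑ h, max (P.g h (w'.1 i)) 0) (P.linearFeasible z) w

/-- The right-hand side of the quadratic cut for `f_i` at `c`, evaluated at `x`. -/
noncomputable def soCut (i : Fin N) (c x : EuclideanSpace ℝ (Fin n)) : ℝ :=
  P.f i c + inner ℝ (gradient (P.f i) c) (x - c) + P.μ i / 2 * ‖x - c‖ ^ 2

/-- The cuts generated at the point `c = (x_1^ℓ, …, x_N^ℓ)`: quadratic cuts for the objectives at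
feasible `x_i^ℓ`; linear cuts for the active constraints at feasible `x_i^ℓ` on the boundary; and
feasibility cuts for all constraints if some `x_i^ℓ` is infeasible. -/
def SatisfiesCuts (c : Fin N → EuclideanSpace ℝ (Fin n)) (s : MasterPoint N K n) : Prop :=
  (∀ i, c i ∈ P.X → P.soCut i (c i) (s.pt.1 i) ≤ s.α i) ∧
  (∀ i h, c i ∈ P.X → c i ∈ frontier P.X → P.g h (c i) = 0 →
    inner ℝ (gradient (P.g h) (c i)) (s.pt.1 i - c i) ≤ 0) ∧
  ((∃ i, c i ∉ P.X) → ∀ i h,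
    P.g h (c i) + inner ℝ (gradient (P.g h) (c i)) (s.pt.1 i - c i) ≤ 0)

/-- The feasible set of the master problem at iteration `k`, with the cuts generated at the points
of the iterations `1, …, k`. -/
def masterFeasible (w : ℕ → Point N K n) (k : ℕ) : Set (MasterPoint N K n) :=
  {s | (∀ ℓ ∈ Finset.Icc 1 k, P.SatisfiesCuts (w ℓ).1 s) ∧ s.pt ∈ P.linearFeasible s.z ∧
    P.CardOK s.z}

/-- `s` is an optimal solution of the master problem `min ∑ i, α_i` at iteration `k`. -/
def IsMasterOptimal (w : ℕ → Point N K n) (k : ℕ) (s : MasterPoint N K n) : Prop :=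
  IsOptimal (fun s' : MasterPoint N K n => ∑ i, s'.α i) (P.masterFeasible w k) s

/-- The master point obtained from `(x̃, ỹ)` with `α_i = f_i(x_i)` and the binary vectors `z`. -/
def lift (w : Point N K n) (z : Binary K n) : MasterPoint N K n :=
  ⟨fun i => P.f i (w.1 i), w, z⟩

/-- A run of the algorithm from feasible binary vectors `z⁰`, without stopping rule: iteration
`k ≥ 1` solves the primal problem for `z^{k-1}` (or computes an infeasibility point if it has no
feasible point), which gives `w k`, adds the cuts at `w k`, and then solves the master problem,
which gives `s k` and its binary part `z^k`. The values `w 0` and `s 0` are not used. -/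
structure IsRun (z : ℕ → Binary K n) (w : ℕ → Point N K n) (s : ℕ → MasterPoint N K n) :
    Prop where
  card_init : P.CardOK (z 0)
  feasible_init : (P.primalFeasible (z 0)).Nonempty
  primal : ∀ k, (P.primalFeasible (z k)).Nonempty →
    IsOptimal P.objective (P.primalFeasible (z k)) (w (k + 1))
  infeasible : ∀ k, ¬ (P.primalFeasible (z k)).Nonempty → P.IsInfeasibilityPoint (z k) (w (k + 1))
  master : ∀ k, P.IsMasterOptimal w (k + 1) (s (k + 1))
  binary : ∀ k, z (k + 1) = (s (k + 1)).z

end Problem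

end DiPOA

/-! There are only finitely many binary vectors, so from some iteration on the binary part of each
master solution equals some `z j` already treated, and the cuts at `w (j + 1)` are present. Three
facts then settle the matter. The master problem is a relaxation of the consensus form: convexity
makes every cut valid, whatever its base point (`exists_lift_mem_masterFeasible`). If the primal
problem for `z j` is infeasible, its cuts exclude `z j` from the master problem: a point satisfying
them would give a descent direction at the infeasibility point
(`not_satisfiesCuts_of_isInfeasibilityPoint`). So a repeated `z j` has a feasible primal problem. In
that case the constraint qualification and first-order optimality bound the master value below by
the primal optimum (`objective_le_sum_of_satisfiesCuts`). As the primal optimum is itself feasible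
for the relaxation, equality holds, and the quadratic terms force the two points to coincide. -/

namespace DiPOA

open Filter Topology

/-! ### First- and second-order estimates along lines -/

section Calculus

variable {F : Type*} [NormedAddCommGroup F] [NormedSpace ℝ F]

/-- The derivative of a differentiable function along the line through `c` with direction `e`. -/
lemma hasDerivAt_along_line {G : Type*} [NormedAddCommGroup G] [NormedSpace ℝ G] {f : F → G}
    (hf : Differentiable ℝ f) (c e : F) (t : ℝ) :
    HasDerivAt (fun t : ℝ => f (c + t • e)) (fderiv ℝ f (c + t • e) e) t := by
  have h1 : HasDerivAt (fun t : ℝ => c + t • e) e t := by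
    simpa using ((hasDerivAt_id t).smul_const e).const_add c
  exact (hf (c + t • e)).hasFDerivAt.comp_hasDerivAt t h1

/-- A function whose second derivative is at least `m` lies above its quadratic model. -/
lemma quadratic_model_le {f : F → ℝ} {m : ℝ} (hf : Differentiable ℝ f)
    (hf' : Differentiable ℝ (fderiv ℝ f))
    (hm : ∀ x v, m * ‖v‖ ^ 2 ≤ fderiv ℝ (fderiv ℝ f) x v v) (c e : F) :
    f c + fderiv ℝ f c e + m / 2 * ‖e‖ ^ 2 ≤ f (c + e) := by
  -- This is the derivative of the gap between `f` and its quadratic model along the line. It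
  -- vanishes at `0` and is monotone by the Hessian bound, so the gap increases on `[0, 1]`.
  have hslope : Monotone fun t : ℝ =>
      fderiv ℝ f (c + t • e) e - fderiv ℝ f c e - m * ‖e‖ ^ 2 * t := by
    have hd : ∀ t : ℝ, HasDerivAt (fun t : ℝ =>
        fderiv ℝ f (c + t • e) e - fderiv ℝ f c e - m * ‖e‖ ^ 2 * t)
        (fderiv ℝ (fderiv ℝ f) (c + t • e) e e - m * ‖e‖ ^ 2) t := by
      intro t
      have h1 := ((hasDerivAt_along_line hf' c e t).clm_apply (hasDerivAt_const t e))
      refine ((h1.sub_const (fderiv ℝ f c e)).sub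
        ((hasDerivAt_id t).const_mul (m * ‖e‖ ^ 2))).congr_deriv ?_
      simp
    refine monotone_of_deriv_nonneg (fun t => (hd t).differentiableAt) fun t => ?_
    rw [(hd t).deriv]
    exact sub_nonneg.2 (hm _ _)
  have hgap : ∀ t : ℝ, HasDerivAt (fun t : ℝ =>
      f (c + t • e) - fderiv ℝ f c e * t - m / 2 * ‖e‖ ^ 2 * t ^ 2)
      (fderiv ℝ f (c + t • e) e - fderiv ℝ f c e - m * ‖e‖ ^ 2 * t) t := by
    intro t
    have h1 := ((hasDerivAt_along_line hf c e t).sub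
      ((hasDerivAt_id t).const_mul (fderiv ℝ f c e))).sub
      ((hasDerivAt_pow 2 t).const_mul (m / 2 * ‖e‖ ^ 2))
    refine h1.congr_deriv ?_
    norm_num
    ring
  have hmono : MonotoneOn (fun t : ℝ =>
      f (c + t • e) - fderiv ℝ f c e * t - m / 2 * ‖e‖ ^ 2 * t ^ 2) (Set.Icc 0 1) := by
    refine monotoneOn_of_deriv_nonneg (convex_Icc 0 1)
      (fun t _ => (hgap t).continuousAt.continuousWithinAt)
      (fun t _ => (hgap t).differentiableAt.differentiableWithinAt) fun t ht => ?_
    rw [interior_Icc] at ht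
    rw [(hgap t).deriv]
    simpa using hslope ht.1.le
  have h01 := hmono (Set.left_mem_Icc.2 zero_le_one) (Set.right_mem_Icc.2 zero_le_one) zero_le_one
  simp only [zero_smul, one_smul, add_zero] at h01
  linarith

/-- A differentiable convex function lies above its tangents. -/
lemma tangent_le_of_convexOn {g : F → ℝ} (hg : Differentiable ℝ g)
    (hc : ConvexOn ℝ Set.univ g) (c e : F) : g c + fderiv ℝ g c e ≤ g (c + e) := by
  have hconv : ConvexOn ℝ Set.univ fun t : ℝ => g (c + t • e) := by
    have := hc.comp_affineMap (AffineMap.lineMap (k := ℝ) c (c + e))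
    rw [Set.preimage_univ] at this
    refine this.congr fun t _ => ?_
    simp [AffineMap.lineMap_apply, add_comm]
  have hd := hasDerivAt_along_line hg c e 0
  have := hconv.le_slope_of_hasDerivAt (Set.mem_univ 0) (Set.mem_univ 1) zero_lt_one hd
  simp [slope_def_field] at this
  linarith

/-- Functions whose linearizations at `0` are nonpositive at `1` decrease at unit relative rate to
first order. -/
lemma exists_le_one_sub_mul_add {ι : Type*} [Finite ι] {φ : ι → ℝ → ℝ} {φ' : ι → ℝ}
    (hφ : ∀ a, HasDerivAt (φ a) (φ' a) 0) (hneg : ∀ a, φ a 0 + φ' a ≤ 0) {ε : ℝ} (hε : 0 < ε) :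
    ∃ t, 0 < t ∧ t < 1 ∧ ∀ a, φ a t ≤ (1 - t) * φ a 0 + t * ε := by
  have hev : ∀ a, ∀ᶠ t in 𝓝[>] (0 : ℝ), φ a t ≤ (1 - t) * φ a 0 + t * ε := by
    intro a
    have hs := (hasDerivAt_iff_tendsto_slope.1 (hφ a)).mono_left
      (nhdsWithin_mono 0 fun t (ht : 0 < t) => ht.ne')
    filter_upwards [hs.eventually_lt_const (show φ' a < -φ a 0 + ε by linarith [hneg a]),
      self_mem_nhdsWithin] with t ht ht0
    rw [Set.mem_Ioi] at ht0
    rw [slope_def_field, sub_zero, div_lt_iff₀ ht0] at ht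
    nlinarith
  have h01 : ∀ᶠ t in 𝓝[>] (0 : ℝ), t ∈ Set.Ioo (0 : ℝ) 1 := Ioo_mem_nhdsGT zero_lt_one
  obtain ⟨t, ht, hall⟩ := (h01.and (eventually_all.2 hev)).exists
  exact ⟨t, ht.1, ht.2, hall⟩

end Calculus

/-! ### Validity of the cuts -/

namespace Problem

variable {N K n H p q : ℕ} {P : Problem N K n H p q}

lemma soCut_le (hf : ∀ i, IsStronglyConvex (P.μ i) (P.f i)) (i : Fin N)
    (c x : EuclideanSpace ℝ (Fin n)) : P.soCut i c x ≤ P.f i x := by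
  obtain ⟨-, h1, h2, h3⟩ := hf i
  have := quadratic_model_le h1 h2 h3 c (x - c)
  rw [add_sub_cancel] at this
  rwa [soCut, inner_gradient_left]

/-- Linearizations of the constraints underestimate them. -/
lemma linearization_le (hg : ∀ h, Differentiable ℝ (P.g h))
    (hc : ∀ h, ConvexOn ℝ Set.univ (P.g h)) (h : Fin H) (c x : EuclideanSpace ℝ (Fin n)) :
    P.g h c + inner ℝ (gradient (P.g h) c) (x - c) ≤ P.g h x := by
  have := tangent_le_of_convexOn (hg h) (hc h) c (x - c)
  rw [add_sub_cancel] at this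
  rwa [inner_gradient_left]

/-- Every feasible point of the consensus form is feasible for all master problems, with the
binary vectors that indicate the supports of the `y_j`. -/
lemma exists_lift_mem_masterFeasible (hf : ∀ i, IsStronglyConvex (P.μ i) (P.f i))
    (hg : ∀ h, Differentiable ℝ (P.g h)) (hc : ∀ h, ConvexOn ℝ Set.univ (P.g h))
    (hE : ∀ j, (P.E j).Nonempty) (hM : ∀ j, ∀ x ∈ P.Ω, ∀ l, |x l| ≤ P.M j)
    {v : Point N K n} (hv : v ∈ P.consensusFeasible) :
    ∃ z, ∀ w k, P.lift v z ∈ P.masterFeasible w k := by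
  obtain ⟨hvg, hvc, hvΩ, hvl⟩ := hv
  refine ⟨fun j l => decide (v.2 j l ≠ 0), fun w k => ⟨fun ℓ _ => ⟨?_, ?_, ?_⟩, ?_, ?_⟩⟩
  · exact fun i _ => soCut_le hf i _ _
  · intro i h _ _ h0
    have := linearization_le hg hc h ((w ℓ).1 i) (v.1 i)
    rw [h0, zero_add] at this
    exact this.trans (hvg i h)
  · exact fun _ i h => (linearization_le hg hc h ((w ℓ).1 i) (v.1 i)).trans (hvg i h)
  · refine ⟨hvc, hvΩ, fun j l => ?_⟩
    -- Some node shares its copy with `y_j`, which carries the bound on `Ω` over to `y_j`.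
    obtain ⟨i, hi⟩ := hE j
    have hb : |v.2 j l| ≤ P.M j := hvc j i hi ▸ hM j _ (hvΩ i) l
    by_cases h0 : v.2 j l = 0
    · simp [lift, h0]
    · simpa [lift, h0] using abs_le.1 hb
  · intro j
    refine le_trans (le_of_eq ?_) (hvl j)
    simp only [lift, l0, Finset.card_filter]
    refine Finset.sum_congr rfl fun l _ => ?_
    by_cases h0 : v.2 j l = 0 <;> simp [h0]

/-- A sparse binary pattern bounds the number of nonzero entries of the `y_j`. -/
lemma primalFeasible_subset_consensusFeasible {z : Binary K n} (hz : P.CardOK z) :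
    P.primalFeasible z ⊆ P.consensusFeasible := by
  rintro w ⟨⟨hwc, hwΩ, hwM⟩, hwg⟩
  refine ⟨hwg, hwc, hwΩ, fun j => le_trans ?_ (hz j)⟩
  rw [l0, Finset.card_filter]
  refine Finset.sum_le_sum fun l _ => ?_
  cases hzl : z j l
  · have h0 : w.2 j l = 0 := by
      have := hwM j l
      simp only [hzl, Bool.toNat_false, Nat.cast_zero, mul_zero, neg_zero] at this
      exact le_antisymm this.2 this.1
    simp [h0]
  · by_cases h0 : w.2 j l = 0 <;> simp [h0]

/-! ### Exactness of the cuts at primal optima -/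

lemma hasFDerivAt_sum_comp_fst {φ : Fin N → EuclideanSpace ℝ (Fin n) → ℝ}
    (hφ : ∀ i, Differentiable ℝ (φ i)) (w : Point N K n) :
    HasFDerivAt (fun w : Point N K n => ∑ i, φ i (w.1 i))
      (∑ i, (fderiv ℝ (φ i) (w.1 i)).comp
        ((ContinuousLinearMap.proj i).comp (ContinuousLinearMap.fst ℝ _ _))) w := by
  refine HasFDerivAt.fun_sum fun i _ => ?_
  exact (hφ i (w.1 i)).hasFDerivAt.comp w
    ((ContinuousLinearMap.proj (R := ℝ) (φ := fun _ : Fin N => EuclideanSpace ℝ (Fin n)) i).comp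
      (ContinuousLinearMap.fst ℝ _ (Fin K → EuclideanSpace ℝ (Fin n)))).hasFDerivAt

/-- An active constraint has zero gradient at an interior point of the feasible set. -/
lemma fderiv_eq_zero_of_mem_interior {h : Fin H} {x : EuclideanSpace ℝ (Fin n)}
    (hx : x ∈ interior P.X) (h0 : P.g h x = 0) : fderiv ℝ (P.g h) x = 0 := by
  have hmax : IsLocalMax (P.g h) x := by
    filter_upwards [mem_interior_iff_mem_nhds.1 hx] with u hu
    rw [h0]
    exact hu.2 h
  exact hmax.fderiv_eq_zero

/-- The difference between a point that satisfies the linear constraints and the active cuts at `w`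
and the point `w` itself is a linearized feasible direction. -/
lemma sub_mem_linearizedCone {z : Binary K n} {w : Point N K n} (hw : w ∈ P.primalFeasible z)
    {s : MasterPoint N K n} (hs : s.pt ∈ P.linearFeasible z) (hcut : P.SatisfiesCuts w.1 s) :
    s.pt - w ∈ P.linearizedCone z w := by
  obtain ⟨⟨hwc, hwΩ, hwM⟩, hwg⟩ := hw
  obtain ⟨hsc, hsΩ, hsM⟩ := hs
  refine ⟨fun i h h0 => ?_, fun j i hi => ?_, fun i r hr => ?_, fun i => ?_, fun j l => ⟨?_, ?_⟩⟩
  · have hX : w.1 i ∈ P.X := ⟨hwΩ i, hwg i⟩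
    -- Active cuts exist only on the frontier; at an interior point the gradient vanishes and no cut
    -- is needed.
    by_cases hint : w.1 i ∈ interior P.X
    · rw [inner_gradient_left, fderiv_eq_zero_of_mem_interior hint h0]
      simp
    · exact hcut.2.1 i h hX ⟨subset_closure hX, hint⟩ h0
  · simp [hsc j i hi, hwc j i hi]
  · have := (hsΩ i).1 r
    simp only [Prod.fst_sub, Pi.sub_apply, WithLp.ofLp_sub, Matrix.mulVec_sub]
    linarith
  · simp [Matrix.mulVec_sub, (hsΩ i).2, (hwΩ i).2]
  · intro h
    have := (hsM j l).2
    simp only [Prod.snd_sub, Pi.sub_apply, PiLp.sub_apply]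
    linarith
  · intro h
    have := (hsM j l).1
    simp only [Prod.snd_sub, Pi.sub_apply, PiLp.sub_apply]
    linarith

/-- The cuts at an optimal solution `w` of the primal problem for `z` bound the master objective
from below on the master points with binary part `z`, and the bound is attained only at `w`. -/
lemma objective_le_sum_of_satisfiesCuts (hf : ∀ i, IsStronglyConvex (P.μ i) (P.f i))
    (hE : ∀ j, (P.E j).Nonempty) {z : Binary K n} {w : Point N K n}
    (hw : IsOptimal P.objective (P.primalFeasible z) w) (hCQ : P.ConstraintQualification z w)
    {s : MasterPoint N K n} (hs : s.pt ∈ P.linearFeasible z) (hcut : P.SatisfiesCuts w.1 s) :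
    P.objective w ≤ ∑ i, s.α i ∧
      (∑ i, s.α i ≤ P.objective w → s.pt = w ∧ ∀ i, s.α i = P.f i (s.pt.1 i)) := by
  -- The constraint qualification makes the linearized direction `s.pt - w` tangent, and the
  -- objective has nonnegative derivative along tangent directions at a minimizer.
  have hdir : 0 ≤ ∑ i, fderiv ℝ (P.f i) (w.1 i) (s.pt.1 i - w.1 i) := by
    have h := hw.2.localize.hasFDerivWithinAt_nonneg
      (hasFDerivAt_sum_comp_fst (fun i => (hf i).2.1) w).hasFDerivWithinAt
      (hCQ (sub_mem_linearizedCone hw.1 hs hcut))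
    simpa [sum_apply] using h
  have hlow : ∀ i, P.f i (w.1 i) + fderiv ℝ (P.f i) (w.1 i) (s.pt.1 i - w.1 i) +
      P.μ i / 2 * ‖s.pt.1 i - w.1 i‖ ^ 2 ≤ s.α i := by
    intro i
    have := hcut.1 i ⟨hw.1.1.2.1 i, hw.1.2 i⟩
    rwa [soCut, inner_gradient_left] at this
  have hsum := Finset.sum_le_sum fun i (_ : i ∈ Finset.univ) => hlow i
  simp only [Finset.sum_add_distrib] at hsum
  have hquad : ∀ i, 0 ≤ P.μ i / 2 * ‖s.pt.1 i - w.1 i‖ ^ 2 := fun i =>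
    mul_nonneg (half_pos (hf i).1).le (sq_nonneg _)
  have hquads := Finset.sum_nonneg fun i (_ : i ∈ Finset.univ) => hquad i
  rw [objective]
  refine ⟨by linarith, fun hle => ?_⟩
  have hx : ∀ i, s.pt.1 i = w.1 i := by
    have hzero : ∑ i, P.μ i / 2 * ‖s.pt.1 i - w.1 i‖ ^ 2 = 0 := by linarith
    intro i
    have hi := (Finset.sum_eq_zero_iff_of_nonneg fun i _ => hquad i).1 hzero i (Finset.mem_univ i)
    have hμ := (half_pos (hf i).1).ne'
    simpa [hμ, sub_eq_zero, (hf i).1.ne'] using hi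
  have hpt : s.pt = w := by
    refine Prod.ext (funext hx) (funext fun j => ?_)
    obtain ⟨i, hi⟩ := hE j
    rw [← hs.1 j i hi, ← hw.1.1.1 j i hi, hx i]
  refine ⟨hpt, fun i => ?_⟩
  -- Termwise bounds together with equal sums force termwise equality.
  have hα : ∀ i, P.f i (w.1 i) ≤ s.α i := fun i => by simpa [hx i] using hlow i
  have heq := (Finset.sum_eq_sum_iff_of_le fun i _ => hα i).1
    (le_antisymm (Finset.sum_le_sum fun i _ => hα i) hle) i (Finset.mem_univ i)
  rw [hx i, heq]

/-! ### Exclusion of infeasible binary vectors -/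

lemma convex_Ω : Convex ℝ P.Ω := by
  rintro x ⟨hx1, hx2⟩ y ⟨hy1, hy2⟩ a b ha hb hab
  refine ⟨fun r => ?_, ?_⟩
  · simp only [WithLp.ofLp_add, WithLp.ofLp_smul, Matrix.mulVec_add, Matrix.mulVec_smul,
      Pi.add_apply, Pi.smul_apply, smul_eq_mul]
    calc _ ≤ a * P.d r + b * P.d r := by gcongr; exacts [hx1 r, hy1 r]
      _ = P.d r := by rw [← add_mul, hab, one_mul]
  · simp only [WithLp.ofLp_add, WithLp.ofLp_smul, Matrix.mulVec_add, Matrix.mulVec_smul, hx2, hy2]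
    rw [← add_smul, hab, one_smul]

lemma convex_linearFeasible (z : Binary K n) : Convex ℝ (P.linearFeasible z) := by
  rintro x ⟨hxc, hxΩ, hxM⟩ y ⟨hyc, hyΩ, hyM⟩ a b ha hb hab
  refine ⟨fun j i hi => ?_, fun i => convex_Ω (hxΩ i) (hyΩ i) ha hb hab, fun j l => ?_⟩
  · simp [hxc j i hi, hyc j i hi]
  · simpa using (convex_Icc (-(P.M j * ((z j l).toNat : ℝ))) (P.M j * ((z j l).toNat : ℝ)))
      (hxM j l) (hyM j l) ha hb hab

/-- The feasibility cuts at `w` exclude every point of `L(z)` if `w` minimizes over `L(z)`, with a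
positive value, the sum of the constraint functions transformed by a `ψ` that preserves first-order
decrease; `ψ` is the identity or the positive part in the applications. -/
lemma not_feasibilityCuts_of_isOptimal (hg : ∀ h, Differentiable ℝ (P.g h)) {ψ : ℝ → ℝ}
    (hψ : ∀ u v t ε : ℝ, 0 < t → t < 1 → 0 < ε → v ≤ (1 - t) * u + t * ε →
      ψ v ≤ (1 - t) * ψ u + t * ε)
    {z : Binary K n} {w : Point N K n}
    (hw : IsOptimal (fun w' : Point N K n => ∑ i, ∑ h, ψ (P.g h (w'.1 i))) (P.linearFeasible z) w)
    (hpos : 0 < ∑ i, ∑ h, ψ (P.g h (w.1 i))) {v : Point N K n} (hv : v ∈ P.linearFeasible z) :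
    ¬ ∀ i h, P.g h (w.1 i) + inner ℝ (gradient (P.g h) (w.1 i)) (v.1 i - w.1 i) ≤ 0 := by
  intro hcut
  set V := ∑ i, ∑ h, ψ (P.g h (w.1 i)) with hV
  -- With slack `V / (N * H + 1)` per constraint, the `N * H` slacks add up to less than `V`, so a
  -- small step from `w` towards `v` lowers the sum below its minimum `V`.
  have hcard : (0 : ℝ) < N * H + 1 := by positivity
  obtain ⟨t, ht0, ht1, ht⟩ := exists_le_one_sub_mul_add (ι := Fin N × Fin H)
    (φ := fun a t => P.g a.2 (w.1 a.1 + t • (v.1 a.1 - w.1 a.1)))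
    (φ' := fun a => fderiv ℝ (P.g a.2) (w.1 a.1) (v.1 a.1 - w.1 a.1))
    (fun a => by simpa using hasDerivAt_along_line (hg a.2) (w.1 a.1) (v.1 a.1 - w.1 a.1) 0)
    (fun a => by simpa [inner_gradient_left] using hcut a.1 a.2)
    (div_pos hpos hcard)
  have hmem : w + t • (v - w) ∈ P.linearFeasible z :=
    (convex_linearFeasible z).add_smul_sub_mem hw.1 hv ⟨ht0.le, ht1.le⟩
  have hmin : V ≤ ∑ i, ∑ h, ψ (P.g h (w.1 i + t • (v.1 i - w.1 i))) := hw.2 hmem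
  have hle : ∑ i, ∑ h, ψ (P.g h (w.1 i + t • (v.1 i - w.1 i))) ≤
      ∑ i, ∑ h, ((1 - t) * ψ (P.g h (w.1 i)) + t * (V / (N * H + 1))) := by
    refine Finset.sum_le_sum fun i _ => Finset.sum_le_sum fun h _ => ?_
    exact hψ _ _ _ _ ht0 ht1 (div_pos hpos hcard) (by simpa using ht (i, h))
  have hval : ∑ i : Fin N, ∑ h : Fin H, ((1 - t) * ψ (P.g h (w.1 i)) + t * (V / (N * H + 1))) =
      (1 - t) * V + t * (N * H * (V / (N * H + 1))) := by
    simp only [Finset.sum_add_distrib, ← Finset.mul_sum, ← hV, Finset.sum_const, Finset.card_univ,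
      Fintype.card_fin, nsmul_eq_mul]
    ring
  have hfrac : N * H * (V / (N * H + 1)) < V := by
    rw [mul_div_assoc', div_lt_iff₀ hcard]
    nlinarith
  nlinarith

/-- The cuts at an infeasibility point for `z` exclude the binary vectors `z`. -/
lemma not_satisfiesCuts_of_isInfeasibilityPoint (hg : ∀ h, Differentiable ℝ (P.g h))
    {z : Binary K n} {w : Point N K n} (hz : ¬ (P.primalFeasible z).Nonempty)
    (hw : P.IsInfeasibilityPoint z w) {s : MasterPoint N K n} (hs : s.pt ∈ P.linearFeasible z) :
    ¬ P.SatisfiesCuts w.1 s := by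
  intro hcut
  have hmem : w ∈ P.linearFeasible z := hw.elim (fun h => h.1.1) fun h => h.1
  -- One violated constraint triggers the feasibility cuts for all `i` and `h`, and makes the sum of
  -- violations positive.
  obtain ⟨i, h, hpos⟩ : ∃ i h, 0 < P.g h (w.1 i) := by
    by_contra! hcon
    exact hz ⟨w, hmem, hcon⟩
  have hlin := hcut.2.2 ⟨i, fun hX => (hX.2 h).not_gt hpos⟩
  rcases hw with ⟨hopt, hsum⟩ | hopt
  · exact not_feasibilityCuts_of_isOptimal (ψ := id) hg
      (fun _ _ _ _ _ _ _ h => h) hopt hsum hs hlin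
  · refine not_feasibilityCuts_of_isOptimal (ψ := fun u => max u 0) hg ?_ hopt ?_ hs hlin
    · intro u v t ε ht0 ht1 hε hv
      have h1 : 0 ≤ 1 - t := by linarith
      refine max_le (hv.trans ?_) (by positivity)
      gcongr
      exact le_max_left _ _
    · have hnn : ∀ i h, 0 ≤ max (P.g h (w.1 i)) 0 := fun i h => le_max_right _ _
      exact Finset.sum_pos' (fun i _ => Finset.sum_nonneg fun h _ => hnn i h)
        ⟨i, Finset.mem_univ i, Finset.sum_pos' (fun h _ => hnn i h)
          ⟨h, Finset.mem_univ h, lt_max_of_lt_left hpos⟩⟩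

/-! ### Binary vectors along a run and their repetition -/

lemma IsRun.cardOK {z : ℕ → Binary K n} {w : ℕ → Point N K n} {s : ℕ → MasterPoint N K n}
    (hrun : P.IsRun z w s) (k : ℕ) : P.CardOK (z k) := by
  cases k with
  | zero => exact hrun.card_init
  | succ k =>
    rw [hrun.binary k]
    exact (hrun.master k).1.2.2

end Problem

/-- From some index on, a sequence in a finite type only takes values that it has taken before. -/
lemma exists_forall_ge_exists_lt_eq {β : Type*} [Finite β] (z : ℕ → β) :
    ∃ k₀, ∀ k ≥ k₀, ∃ j < k, z j = z k := by
  -- `first b` is some index at which `b` occurs, not necessarily the least; only boundedness of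
  -- these indices matters.
  choose first hfirst using fun b : Set.range z => b.2
  obtain ⟨B, hB⟩ := (Set.finite_range first).bddAbove
  refine ⟨B + 1, fun k hk => ⟨first ⟨z k, k, rfl⟩, ?_, hfirst ⟨z k, k, rfl⟩⟩⟩
  have := hB (Set.mem_range_self (⟨z k, k, rfl⟩ : Set.range z))
  omega

end DiPOA

theorem mainTheorem2 {N K n H p q : ℕ} (P : DiPOA.Problem N K n H p q)
    (hf : ∀ i, DiPOA.IsStronglyConvex (P.μ i) (P.f i))
    (hg_smooth : ∀ h, ContDiff ℝ 1 (P.g h))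
    (hg_convex : ∀ h, ConvexOn ℝ Set.univ (P.g h))
    (hΩ : Bornology.IsBounded P.Ω)
    (hE : ∀ j, (P.E j).Nonempty)
    (hM : ∀ j, ∀ x ∈ P.Ω, ∀ l, |x l| ≤ P.M j)
    (hCQ : ∀ z, P.CardOK z → ∀ w,
      DiPOA.IsOptimal P.objective (P.primalFeasible z) w → P.ConstraintQualification z w) :
    -- the quadratic cuts are global underestimators
    (∀ i c x, P.soCut i c x ≤ P.f i x) ∧
    -- no feasible point of the sparse convex program, or of its consensus form, is cut off
    (∀ x ∈ P.scpFeasible, ∃ z, ∀ w k,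
      P.lift (fun _ => x, fun _ => x) z ∈ P.masterFeasible w k) ∧
    (∀ v ∈ P.consensusFeasible, ∃ z, ∀ w k, P.lift v z ∈ P.masterFeasible w k) ∧
    -- finite convergence
    (∀ z w s, P.IsRun z w s → ∃ kstar : ℕ, ∀ k ≥ kstar,
      DiPOA.IsOptimal P.objective P.consensusFeasible (s k).pt ∧
      (∀ i, (s k).α i = P.f i ((s k).pt.1 i)) ∧
      ∀ v, DiPOA.IsOptimal P.objective P.consensusFeasible v →
        ∃ z', P.IsMasterOptimal w k (P.lift v z')) := by
  have hg : ∀ h, Differentiable ℝ (P.g h) := fun h => (hg_smooth h).differentiable one_ne_zero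
  have hlift : ∀ v ∈ P.consensusFeasible, ∃ z, ∀ w k, P.lift v z ∈ P.masterFeasible w k :=
    fun v hv => DiPOA.Problem.exists_lift_mem_masterFeasible hf hg hg_convex hE hM hv
  refine ⟨DiPOA.Problem.soCut_le hf, fun x hx => hlift (fun _ => x, fun _ => x) ?_, hlift, ?_⟩
  · exact ⟨fun _ => hx.1.2, fun _ _ _ => rfl, fun _ => hx.1.1, fun _ => hx.2⟩
  intro z w s hrun
  obtain ⟨k₀, hk₀⟩ := DiPOA.exists_forall_ge_exists_lt_eq z
  refine ⟨k₀, fun k hk => ?_⟩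
  obtain ⟨j, hjk, hj⟩ := hk₀ k hk
  obtain ⟨k, rfl⟩ := Nat.exists_eq_add_one_of_ne_zero (Nat.ne_zero_of_lt hjk)
  have hmaster := hrun.master k
  -- The primal step for `z j` yields `w (j + 1)`, and `j < k + 1` places its cuts in the master
  -- problem of iteration `k + 1`.
  have hcut := hmaster.1.1 (j + 1) (Finset.mem_Icc.2 ⟨by omega, by omega⟩)
  have hlin : (s (k + 1)).pt ∈ P.linearFeasible (z j) := by
    rw [hj, hrun.binary k]
    exact hmaster.1.2.1
  have hfeas : (P.primalFeasible (z j)).Nonempty := by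
    by_contra hinf
    exact DiPOA.Problem.not_satisfiesCuts_of_isInfeasibilityPoint hg hinf
      (hrun.infeasible j hinf) hlin hcut
  have hopt := hrun.primal j hfeas
  have hcard := hrun.cardOK j
  have hcons : w (j + 1) ∈ P.consensusFeasible :=
    DiPOA.Problem.primalFeasible_subset_consensusFeasible hcard hopt.1
  have hbound : ∀ v ∈ P.consensusFeasible, ∑ i, (s (k + 1)).α i ≤ P.objective v := by
    intro v hv
    obtain ⟨z', hz'⟩ := hlift v hv
    exact hmaster.2 (hz' w (k + 1))
  obtain ⟨hlow, heq⟩ := DiPOA.Problem.objective_le_sum_of_satisfiesCuts hf hE hopt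
    (hCQ (z j) hcard _ hopt) hlin hcut
  -- The relaxation bound at `w (j + 1)` is the reverse of `hlow`, which gives the equality case.
  obtain ⟨hpt, hα⟩ := heq (hbound _ hcons)
  refine ⟨?_, hα, fun v hv => ?_⟩
  · rw [hpt]
    exact ⟨hcons, fun v hv => hlow.trans (hbound v hv)⟩
  · obtain ⟨z', hz'⟩ := hlift v hv.1
    exact ⟨z', hz' w (k + 1), fun s' hs' =>
      ((hv.2 hcons).trans hlow).trans (hmaster.2 hs')⟩
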